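/- Let $G=(V,E)$ be a finite connected planar graph embedded in the plane, and let $J=(J_{uv})_{uv\in E}$, $U=(U_{uv})_{uv\in E}$ be arbitrary real coupling constants. The Ashkin–Teller model is the probability measure on pairs $(\sigma,\tilde\sigma)\in\{-1,1\}^V\times\{-1,1\}^V$ given by $$\mathbf P(\sigma,\tilde\sigma)=\frac1{\mathcal Z}\prod_{uv\in E}\exp\big(J_{uv}(\sigma_u\sigma_v+\tilde\sigma_u\tilde\sigma_v)+U_{uv}(\sigma_u\sigma_v\tilde\sigma_u\tilde\sigma_v+1)\big);$$ $\langle\cdot\rangle$ denotes its expectation. Put $\varphi_v=(\sigma_v+\tilde\sigma_v)/2$ and $\tilde\varphi_v=(\sigma_v-\tilde\sigma_v)/2$. For a function $f$ on $V$ and a finite set $S$ write $f_S=\prod_{v\in S}f_v$ (so $f_\emptyset=1$) and $f^2_S=\prod_{v\in S}f_v^2$. Let $A_1,A_2,B_1,B_2\subseteq V$ be pairwise disjoint sets of vertices lying on the outer face of $G$. Let $\mathcal N$ be the set of nodes, in which each vertex of $A_1\cup B_1$ occurs once and each vertex $v$ of $A_2\cup B_2$ (a doubled vertex) occurs as two copies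 $v^<$, $v^>$. Assume that $|\mathcal N|=2n$ is even, and fix a counterclockwise order $v_1,\dots,v_{2n}$ of $\mathcal N$ along the outer face in which, for each doubled vertex $v$, the copy $v^>$ comes immediately after $v^<$. The nodes coming from $A_1\cup A_2$ form the set $\mathcal R$ of red nodes, and those coming from $B_1\cup B_2$ form the set $\mathcal B$ of blue nodes. Sources are the blue nodes of odd index and the red nodes of even index; sinks are the blue nodes of even index and the red nodes of odd index. The coloring $\mathcal B$ is called unbalanced if the number of sources differs from the number of sinks. Let $\mathcal P(\mathcal N)$ be the set of subsets of $\mathcal N$ of even cardinality. In correlations of $\sigma,\tilde\sigma$ over sets of nodes, nodes are projected onto the corresponding vertices, i.e. $\sigma_{v^<}=\sigma_{v^>}=\sigma_v$ and $\tilde\sigma_{v^<}=\tilde\sigma_{v^>}=\tilde\sigma_v$. If $\mathcal B$ is unbalanced, then for all $J$ and $U$, $$\langle\varphi_{A_1}\varphi^2_{A_2}\tilde\varphi_{B_1}\tilde\varphi^2_{B_2}\rangle=\frac1{2^{|\mathcal N|}}\sum_{S\in\mathcal P(\mathcal N)}(-1)^{|S\cap\mathcal B|}\langle\sigma_{\mathcal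 N\setminus S}\tilde\sigma_S\rangle=0 .$$ If moreover $U=0$, then $\sigma$ and $\tilde\sigma$ are independent and identically distributed, and in particular $\langle\sigma_{\mathcal N\setminus S}\tilde\sigma_S\rangle=\langle\sigma_{\mathcal N\setminus S}\rangle\langle\sigma_S\rangle$ for all $S\subseteq\mathcal N$; and if in addition $|\mathcal B|$ is even, then $$2\langle\sigma_{\mathcal N}\rangle=\sum_{S\in\mathcal P(\mathcal N)\setminus\{\emptyset,\mathcal N\}}(-1)^{|S\cap\mathcal B|+1}\langle\sigma_S\rangle\langle\sigma_{\mathcal N\setminus S}\rangle .$$ -/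

import Mathlib

open scoped BigOperators

noncomputable section

/-! ### Graphs embedded in the plane -/

/-- An embedding of the graph `G` in the plane `ℂ`: vertices are distinct points, every edge is
a simple arc joining its two end vertices, the interior of an edge contains no vertex, and the
interiors of two distinct edges are disjoint. -/
structure PlaneEmbedding {V : Type*} (G : SimpleGraph V) where
  /-- the point representing a vertex -/
  pos : V → ℂ
  /-- the arc representing an edge -/
  arc : G.edgeSet → C(unitInterval, ℂ)
  pos_injective : Function.Injective pos
  arc_injective : ∀ e, Function.Injective (arc e)
  arc_ends : ∀ e, s(arc e 0, arc e 1) = Sym2.map pos (e : Sym2 V)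
  arc_avoids_vertices : ∀ (e : G.edgeSet) (t : unitInterval) (v : V),
    t ≠ 0 → t ≠ 1 → arc e t ≠ pos v
  arc_disjoint : ∀ (e e' : G.edgeSet) (t t' : unitInterval), e ≠ e' →
    t ≠ 0 → t ≠ 1 → t' ≠ 0 → t' ≠ 1 → arc e t ≠ arc e' t'

namespace PlaneEmbedding

variable {V : Type*} {G : SimpleGraph V} (𝓔 : PlaneEmbedding G)

/-- The subset of the plane occupied by the embedded graph. -/
def support : Set ℂ := Set.range 𝓔.pos ∪ ⋃ e, Set.range (𝓔.arc e)

/-- The outer face: the points of the complement of the embedded graph whose connected component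
in this complement is unbounded. -/
def outerFace : Set ℂ :=
  {z | z ∈ 𝓔.supportᶜ ∧ ¬ Bornology.IsBounded (connectedComponentIn 𝓔.supportᶜ z)}

/-- The vertices `v i`, listed in the order of the index set `ι`, are distinct, lie on the
boundary of the outer face, and appear there in counterclockwise order (a vertex which the
boundary visits several times being placed at any one of its visits): one can join them, by
pairwise disjoint simple arcs running through the outer face, to points `R * exp (θ i * I)` of a
circle surrounding the graph, with `θ` strictly increasing and spanning less than one full turn. -/
def IsCounterclockwise {ι : Type*} [LinearOrder ι] (v : ι → V) : Prop :=
  Function.Injective v ∧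
  (∀ i, 𝓔.pos (v i) ∈ frontier 𝓔.outerFace) ∧
  ∃ (R : ℝ) (θ : ι → ℝ) (γ : ι → C(unitInterval, ℂ)),
    𝓔.support ⊆ Metric.ball 0 R ∧
    StrictMono θ ∧
    (∀ i j, θ j < θ i + 2 * Real.pi) ∧
    (∀ i, Function.Injective (γ i)) ∧
    (∀ i, γ i 0 = 𝓔.pos (v i)) ∧
    (∀ i, γ i 1 = (R : ℂ) * Complex.exp ((θ i : ℂ) * Complex.I)) ∧
    (∀ (i : ι) (t : unitInterval), t ≠ 0 → t ≠ 1 → γ i t ∈ 𝓔.outerFace ∩ Metric.ball 0 R) ∧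
    (∀ i j, i ≠ j → Disjoint (Set.range (γ i)) (Set.range (γ j)))

end PlaneEmbedding

/-! ### The Ashkin–Teller model -/

namespace AshkinTeller

/-- Spin configurations: `±1`-valued functions on the vertices. -/
abbrev Config (V : Type*) := V → ℤˣ

section Model

variable {V : Type*}

/-- The spin at a vertex as a real number. -/
def spin (σ : Config V) (v : V) : ℝ := ((σ v : ℤ) : ℝ)

/-- The product `σ_u σ_v` of the spins at the two ends of the edge `e = uv`. -/
def edgeSpin (σ : Config V) (e : Sym2 V) : ℝ :=
  Sym2.lift ⟨fun u v => spin σ u * spin σ v, fun _ _ => mul_comm _ _⟩ e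

/-- `φ_v = (σ_v + σ̃_v) / 2`, where `p = (σ, σ̃)`. -/
def phi (p : Config V × Config V) (v : V) : ℝ := (spin p.1 v + spin p.2 v) / 2

/-- `φ̃_v = (σ_v - σ̃_v) / 2`, where `p = (σ, σ̃)`. -/
def phiTilde (p : Config V × Config V) (v : V) : ℝ := (spin p.1 v - spin p.2 v) / 2

variable [Fintype V] [DecidableEq V] (G : SimpleGraph V) [DecidableRel G.Adj] (J U : Sym2 V → ℝ)

/-- The unnormalised weight of a pair `p = (σ, σ̃)` of spin configurations. -/
def weight (p : Config V × Config V) : ℝ :=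
  ∏ e ∈ G.edgeFinset,
    Real.exp (J e * (edgeSpin p.1 e + edgeSpin p.2 e) +
      U e * (edgeSpin p.1 e * edgeSpin p.2 e + 1))

/-- The partition function. -/
def partitionFunction : ℝ := ∑ p : Config V × Config V, weight G J U p

/-- The probability of a pair of spin configurations. -/
def prob (p : Config V × Config V) : ℝ := weight G J U p / partitionFunction G J U

/-- The Ashkin–Teller law, as a measure on pairs of spin configurations. -/
def law : MeasureTheory.Measure (Config V × Config V) :=
  ∑ p : Config V × Config V, ENNReal.ofReal (prob G J U p) • MeasureTheory.Measure.dirac p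

/-- The expectation `⟨f⟩` under the Ashkin–Teller law. -/
def expect (f : Config V × Config V → ℝ) : ℝ :=
  ∑ p : Config V × Config V, f p * prob G J U p

/-- The correlation `⟨φ_{A₁} φ²_{A₂} φ̃_{B₁} φ̃²_{B₂}⟩`. -/
def phiCorr (A₁ A₂ B₁ B₂ : Finset V) : ℝ :=
  expect G J U fun p =>
    (∏ v ∈ A₁, phi p v) * (∏ v ∈ A₂, phi p v ^ 2) *
      (∏ v ∈ B₁, phiTilde p v) * (∏ v ∈ B₂, phiTilde p v ^ 2)

/-- The correlation `⟨σ_S σ̃_T⟩` for finite sets `S`, `T` of nodes, a node `(v, b)` being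
projected onto its vertex `v`. -/
def spinCorr (S T : Finset (V × Bool)) : ℝ :=
  expect G J U fun p => (∏ x ∈ S, spin p.1 x.1) * ∏ x ∈ T, spin p.2 x.1

end Model

/-! ### Nodes and colorings -/

section Nodes

variable {V : Type*} [DecidableEq V] (A₁ A₂ B₁ B₂ : Finset V)

/-- The nodes: every vertex `v` of the four sets gives a node `(v, false)`, and every doubled
vertex (a vertex of `A₂ ∪ B₂`) a second one. For a doubled vertex, `(v, false)` is `v^<` and
`(v, true)` is `v^>`. -/
def nodes : Finset (V × Bool) :=
  (A₁ ∪ A₂ ∪ B₁ ∪ B₂) ×ˢ {false} ∪ (A₂ ∪ B₂) ×ˢ {true}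

/-- The blue nodes: those coming from `B₁ ∪ B₂`. -/
def blue : Finset (V × Bool) := (nodes A₁ A₂ B₁ B₂).filter fun x => x.1 ∈ B₁ ∪ B₂

/-- The red nodes: those coming from `A₁ ∪ A₂`. -/
def red : Finset (V × Bool) := (nodes A₁ A₂ B₁ B₂).filter fun x => x.1 ∈ A₁ ∪ A₂

/-- `node 0, node 1, …` lists the nodes, each exactly once, in a counterclockwise order along the
outer face in which `v^>` comes immediately after `v^<` for every doubled vertex `v`. -/
structure IsNodeOrder {G : SimpleGraph V} (𝓔 : PlaneEmbedding G) {m : ℕ}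
    (node : Fin m → V × Bool) : Prop where
  injective : Function.Injective node
  image_eq : Finset.univ.image node = nodes A₁ A₂ B₁ B₂
  doubled : ∀ (i j : Fin m) (v : V),
    node i = (v, false) → node j = (v, true) → (j : ℕ) = (i : ℕ) + 1
  counterclockwise :
    𝓔.IsCounterclockwise fun i : {i : Fin m // (node i).2 = false} => (node i).1

variable {m : ℕ} (node : Fin m → V × Bool)

/-- The nodes with odd index, when the nodes are numbered `1, 2, …, m`. -/
def oddNodes : Finset (V × Bool) :=
  (Finset.univ.filter fun i : Fin m => Odd ((i : ℕ) + 1)).image node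

/-- The nodes with even index, when the nodes are numbered `1, 2, …, m`. -/
def evenNodes : Finset (V × Bool) :=
  (Finset.univ.filter fun i : Fin m => Even ((i : ℕ) + 1)).image node

/-- The sources: odd blue nodes and even red nodes. -/
def sources : Finset (V × Bool) :=
  (oddNodes node ∩ blue A₁ A₂ B₁ B₂) ∪ (evenNodes node ∩ red A₁ A₂ B₁ B₂)

/-- The sinks: even blue nodes and odd red nodes. -/
def sinks : Finset (V × Bool) :=
  (evenNodes node ∩ blue A₁ A₂ B₁ B₂) ∪ (oddNodes node ∩ red A₁ A₂ B₁ B₂)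

/-- The coloring is balanced if there are as many sources as sinks. -/
def IsBalanced : Prop :=
  (sources A₁ A₂ B₁ B₂ node).card = (sinks A₁ A₂ B₁ B₂ node).card

/-- The subsets of even cardinality of a set of nodes. -/
def evenSubsets (N : Finset (V × Bool)) : Finset (Finset (V × Bool)) :=
  N.powerset.filter fun S => Even S.card

end Nodes

end AshkinTeller

end

/-! Put `τ = σ σ̃`. A product of fields vanishes unless `τ = -1` at every blue node and `τ = 1` at
every red one. For fixed `τ`, an edge across which `τ` changes sign contributes a factor independent
of `σ`, so the weight is invariant under flipping `σ` on a cluster of `τ`, that is, a component of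
`agreeGraph`. If some cluster contains an odd number of nodes, this flip changes the sign of the
fields and the sum over `σ` vanishes (`sum_nodeField_eq_zero_of_odd`).

Otherwise every cluster contains an even number of nodes. By planarity the clusters partition the
nodes without crossings (`IsNodeOrder.reachable_of_interleaved`). In a noncrossing partition into
even blocks the parities of the indices alternate along each block (`sum_neg_one_pow_block`).
Clusters are monochromatic, so each contains as many sources as sinks and the coloring is balanced.
For an unbalanced coloring every `τ` therefore contributes zero.

The topological input is that two paths in a disc with interleaved endpoints on the circle meet
(`exists_eq_of_interleaved`). If they did not, `γ s - δ t` would have a continuous logarithm,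
whereas its argument winds once around the boundary of the parameter square.

The sum over even subsets comes from expanding the product of fields, odd subsets being killed by
`σ̃ ↦ -σ̃`. For `U = 0` the correlations factor, and isolating the terms `∅` and `N` gives the last
identity. -/

noncomputable section

/-! ### Crossing paths in a disc -/

/-- A nowhere vanishing continuous function on the plane has a continuous logarithm. -/
lemma exists_continuous_log (g : ℝ × ℝ → ℂ) (hg : Continuous g) (h0 : ∀ x, g x ≠ 0) :
    ∃ f : ℝ × ℝ → ℂ, Continuous f ∧ ∀ x, Complex.exp (f x) = g x := by
  obtain ⟨f, ⟨-, hf⟩, -⟩ := Complex.isCoveringMapOn_exp.existsUnique_continuousMap_lifts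
    (⟨g, hg⟩ : C(ℝ × ℝ, ℂ)) (a₀ := 0) (e₀ := Complex.log (g 0)) (Complex.exp_log (h0 0)) h0
  exact ⟨f, f.continuous, fun x => congrFun hf x⟩

lemma lt_of_continuous_of_ne {h : ℝ → ℝ} (hc : Continuous h) {c : ℝ} (hne : ∀ t, h t ≠ c)
    {a b : ℝ} (ha : h a < c) : h b < c := by
  by_contra! hb
  obtain ⟨t, ht⟩ := mem_range_of_exists_le_of_exists_ge hc ⟨a, ha.le⟩ ⟨b, hb⟩
  exact hne t ht

/-- A continuous real function along which the cosine stays positive does not leave its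
interval of positivity of the cosine. -/
lemma int_eq_of_cos_pos {h : ℝ → ℝ} (hc : Continuous h) (hpos : ∀ t, 0 < Real.cos (h t))
    {s t a b : ℝ} {k l : ℤ} (hs : h s = a + k * (2 * Real.pi)) (ht : h t = b + l * (2 * Real.pi))
    (ha : |a| < Real.pi / 2) (hb : |b| < Real.pi / 2) : k = l := by
  have key : ∀ {s t a b : ℝ} {k l : ℤ}, h s = a + k * (2 * Real.pi) →
      h t = b + l * (2 * Real.pi) → |a| < Real.pi / 2 → |b| < Real.pi / 2 → l ≤ k := by
    intro s t a b k l hs ht ha hb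
    rw [abs_lt] at ha hb
    -- The cosine vanishes at this barrier, so `h` cannot cross it.
    have hne : ∀ u, h u ≠ Real.pi / 2 + k * (2 * Real.pi) := fun u hu => by
      have := hpos u
      rw [hu, Real.cos_add_int_mul_two_pi, Real.cos_pi_div_two] at this
      exact this.false
    have h1 : h t < Real.pi / 2 + k * (2 * Real.pi) :=
      lt_of_continuous_of_ne hc hne (by linarith : h s < _)
    have h2 : ((l : ℝ) - k) * (2 * Real.pi) < 1 * (2 * Real.pi) := by linarith
    have h3 : ((l : ℝ) - k) < 1 := lt_of_mul_lt_mul_right h2 Real.two_pi_pos.le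
    have h4 : l - k < 1 := by exact_mod_cast h3
    omega
  exact le_antisymm (key ht hs hb ha) (key hs ht ha hb)

/-- The direction of a chord of a circle. -/
lemma im_log_chord {z : ℂ} {R α β : ℝ} (hR : 0 < R) (h1 : α < β) (h2 : β < α + 2 * Real.pi)
    (hz : Complex.exp z = R * Complex.exp (α * Complex.I) - R * Complex.exp (β * Complex.I)) :
    ∃ k : ℤ, z.im = (α + β) / 2 - Real.pi / 2 + k * (2 * Real.pi) := by
  have hsin : 0 < Real.sin ((β - α) / 2) := Real.sin_pos_of_pos_of_lt_pi (by linarith) (by linarith)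
  -- The chord is `-2 i R sin ((β - α) / 2)` times the exponential at the mean angle. Here `c` is
  -- its length, and the factor `-i` is the shift by `-π / 2`.
  set c : ℝ := R * (2 * Real.sin ((β - α) / 2)) with hc
  have hcpos : 0 < c := by positivity
  have hw : Complex.exp z =
      Complex.exp ((Real.log c : ℂ) + (((α + β) / 2 - Real.pi / 2 : ℝ) : ℂ) * Complex.I) := by
    rw [hz, Complex.exp_add, ← Complex.ofReal_exp, Real.exp_log hcpos, hc]
    have hα : ((α : ℂ) * Complex.I) =
        (((α + β) / 2 : ℝ) : ℂ) * Complex.I + -((((β - α) / 2 : ℝ) : ℂ) * Complex.I) := by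
      push_cast; ring
    have hβ : ((β : ℂ) * Complex.I) =
        (((α + β) / 2 : ℝ) : ℂ) * Complex.I + ((((β - α) / 2 : ℝ) : ℂ) * Complex.I) := by
      push_cast; ring
    have hγ : ((((α + β) / 2 - Real.pi / 2 : ℝ) : ℂ) * Complex.I) =
        (((α + β) / 2 : ℝ) : ℂ) * Complex.I + -((Real.pi : ℂ) / 2 * Complex.I) := by
      push_cast; ring
    have hI : Complex.exp (-((Real.pi : ℂ) / 2 * Complex.I)) = -Complex.I := by
      rw [Complex.exp_neg, Complex.exp_pi_div_two_mul_I, Complex.inv_I]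
    rw [hα, hβ, hγ, Complex.exp_add, Complex.exp_add, Complex.exp_add, hI]
    push_cast
    rw [Complex.sin]
    rw [show -(((β : ℂ) - α) / 2) * Complex.I = -(((β : ℂ) - α) / 2 * Complex.I) by ring]
    linear_combination
      (-(R : ℂ)) * Complex.exp ((α + β) / 2 * Complex.I) *
        (Complex.exp (-(((β : ℂ) - α) / 2 * Complex.I)) - Complex.exp (((β : ℂ) - α) / 2 * Complex.I)) *
        (- Complex.I_sq)
  obtain ⟨k, hk⟩ := Complex.exp_eq_exp_iff_exists_int.1 hw
  refine ⟨k, ?_⟩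
  have := congrArg Complex.im hk
  simpa using this

/-- Seen from a point of a circle, the disc lies in a half-plane. -/
lemma cos_pos_of_exp_eq {z w : ℂ} {R θ : ℝ} (hw : ‖w‖ ≤ R)
    (hz : Complex.exp z = R * Complex.exp (θ * Complex.I) - w) : 0 < Real.cos (z.im - θ) := by
  -- Rotating by `-θ` moves the boundary point to `R`. The real part of `R - u` is then nonnegative,
  -- and it vanishes only for `u = R`, where the exponential would be zero.
  set u := w * Complex.exp (-(θ * Complex.I)) with hu
  have hnorm : ‖u‖ = ‖w‖ := by
    rw [hu, norm_mul, ← neg_mul, ← Complex.ofReal_neg, Complex.norm_exp_ofReal_mul_I, mul_one]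
  have hexp : Complex.exp (z - θ * Complex.I) = R - u := by
    rw [sub_eq_add_neg, Complex.exp_add, hz, sub_mul, mul_assoc, ← Complex.exp_add, add_neg_cancel,
      Complex.exp_zero, mul_one]
  have hre : Real.exp z.re * Real.cos (z.im - θ) = R - u.re := by
    have := congrArg Complex.re hexp
    simpa [Complex.exp_re] using this
  have hle : u.re ≤ R := (Complex.re_le_norm u).trans (hnorm ▸ hw)
  have hne : u.re ≠ R := fun h => by
    have him : u.im = 0 := by
      have h1 : ‖u‖ ^ 2 = u.re ^ 2 + u.im ^ 2 := by
        rw [← Complex.normSq_eq_norm_sq, Complex.normSq_apply]; ring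
      have h2 : ‖u‖ ≤ R := hnorm ▸ hw
      have h3 : 0 ≤ ‖u‖ := norm_nonneg u
      rw [h] at h1
      have h4 : ‖u‖ ^ 2 ≤ R ^ 2 := pow_le_pow_left₀ h3 h2 2
      exact pow_eq_zero_iff (two_ne_zero) |>.1 (le_antisymm (by linarith) (sq_nonneg _))
    have : u = R := Complex.ext (by simpa using h) (by simpa using him)
    exact Complex.exp_ne_zero _ (hexp.trans (by rw [this, sub_self]))
  have : 0 < Real.exp z.re * Real.cos (z.im - θ) := by
    rw [hre]; exact sub_pos.2 (lt_of_le_of_ne hle hne)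
  exact (mul_pos_iff_of_pos_left (Real.exp_pos _)).1 this

/-- Two paths in a disc which join interleaved pairs of boundary points meet. -/
theorem exists_eq_of_interleaved {R θ₁ θ₂ θ₃ θ₄ : ℝ} (hR : 0 < R) (h12 : θ₁ < θ₂) (h23 : θ₂ < θ₃)
    (h34 : θ₃ < θ₄) (h41 : θ₄ < θ₁ + 2 * Real.pi) {γ δ : ℝ → ℂ} (hγ : Continuous γ)
    (hδ : Continuous δ) (hγR : ∀ s, ‖γ s‖ ≤ R) (hδR : ∀ t, ‖δ t‖ ≤ R)
    (hγ0 : γ 0 = R * Complex.exp (θ₁ * Complex.I)) (hγ1 : γ 1 = R * Complex.exp (θ₃ * Complex.I))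
    (hδ0 : δ 0 = R * Complex.exp (θ₂ * Complex.I)) (hδ1 : δ 1 = R * Complex.exp (θ₄ * Complex.I)) :
    ∃ s t, γ s = δ t := by
  by_contra! hne
  obtain ⟨f, hf, hfe⟩ := exists_continuous_log (fun x => γ x.1 - δ x.2) (by fun_prop)
    (fun x => sub_ne_zero.2 (hne _ _))
  have e2 : Complex.exp ((θ₂ + 2 * Real.pi : ℝ) * Complex.I) = Complex.exp (θ₂ * Complex.I) := by
    rw [← Complex.exp_periodic (θ₂ * Complex.I)]; push_cast; ring_nf
  obtain ⟨a, ha⟩ := im_log_chord (z := f (0, 0)) hR h12 (by linarith) (by rw [hfe, hγ0, hδ0])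
  obtain ⟨b, hb⟩ := im_log_chord (z := f (0, 1)) (β := θ₄) hR (h12.trans (h23.trans h34)) h41
    (by rw [hfe, hγ0, hδ1])
  -- The chord formula needs the second angle to be the larger one, hence the full turn added to
  -- `θ₂`. It is the source of the discrepancy `a = c + 1`.
  obtain ⟨c, hc⟩ := im_log_chord (z := f (1, 0)) (α := θ₃) (β := θ₂ + 2 * Real.pi) hR (by linarith)
    (by linarith) (by rw [hfe, hγ1, hδ0, e2])
  obtain ⟨d, hd⟩ := im_log_chord (z := f (1, 1)) hR h34 (by linarith) (by rw [hfe, hγ1, hδ1])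
  -- On each side of the parameter square one path rests at a point of the circle, so the argument
  -- stays in an open half-turn and the branch numbers at the two corners can be compared. The four
  -- comparisons are inconsistent.
  have hab : a = b := by
    refine int_eq_of_cos_pos (h := fun t => (f (0, t)).im - θ₁) (s := 0) (t := 1)
      (a := (θ₂ - θ₁) / 2 - Real.pi / 2) (b := (θ₄ - θ₁) / 2 - Real.pi / 2) (by fun_prop)
      (fun t => cos_pos_of_exp_eq (hδR t) (by rw [hfe, hγ0]))
      (by rw [ha]; ring) (by rw [hb]; ring) ?_ ?_ <;> rw [abs_lt] <;> constructor <;> linarith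
  have hcd : c = d := by
    refine int_eq_of_cos_pos (h := fun t => (f (1, t)).im - θ₃) (s := 0) (t := 1)
      (a := (θ₂ - θ₃) / 2 + Real.pi / 2) (b := (θ₄ - θ₃) / 2 - Real.pi / 2) (by fun_prop)
      (fun t => cos_pos_of_exp_eq (hδR t) (by rw [hfe, hγ1]))
      (by rw [hc]; ring) (by rw [hd]; ring) ?_ ?_ <;> rw [abs_lt] <;> constructor <;> linarith
  have hopp : ∀ (s t θ : ℝ), δ t = R * Complex.exp (θ * Complex.I) →
      0 < Real.cos ((f (s, t)).im - θ + Real.pi) := fun s t θ h => by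
    have h' : Complex.exp (f (s, t) + Real.pi * Complex.I) =
        R * Complex.exp (θ * Complex.I) - γ s := by
      rw [Complex.exp_add, Complex.exp_pi_mul_I, hfe, ← h]; ring
    have := cos_pos_of_exp_eq (hγR s) h'
    simpa [sub_add_eq_add_sub] using this
  have hac : a = c + 1 := by
    refine int_eq_of_cos_pos (h := fun s => (f (s, 0)).im - θ₂ + Real.pi) (s := 0) (t := 1)
      (a := (θ₁ - θ₂) / 2 + Real.pi / 2) (b := (θ₃ - θ₂) / 2 - Real.pi / 2) (by fun_prop)
      (fun s => hopp s 0 θ₂ hδ0)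
      (by rw [ha]; ring) (by rw [hc]; push_cast; ring) ?_ ?_ <;> rw [abs_lt] <;> constructor <;>
      linarith
  have hbd : b = d := by
    refine int_eq_of_cos_pos (h := fun s => (f (s, 1)).im - θ₄ + Real.pi) (s := 0) (t := 1)
      (a := (θ₁ - θ₄) / 2 + Real.pi / 2) (b := (θ₃ - θ₄) / 2 + Real.pi / 2) (by fun_prop)
      (fun s => hopp s 1 θ₄ hδ1)
      (by rw [hb]; ring) (by rw [hd]; ring) ?_ ?_ <;> rw [abs_lt] <;> constructor <;> linarith
  omega

/-- Two path connected subsets of a disc containing interleaved boundary points meet. -/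
theorem nonempty_inter_of_joinedIn {R θ₁ θ₂ θ₃ θ₄ : ℝ} (hR : 0 < R) (h12 : θ₁ < θ₂)
    (h23 : θ₂ < θ₃) (h34 : θ₃ < θ₄) (h41 : θ₄ < θ₁ + 2 * Real.pi) {K L : Set ℂ}
    (hK : K ⊆ Metric.closedBall 0 R) (hL : L ⊆ Metric.closedBall 0 R)
    (hKj : JoinedIn K (R * Complex.exp (θ₁ * Complex.I)) (R * Complex.exp (θ₃ * Complex.I)))
    (hLj : JoinedIn L (R * Complex.exp (θ₂ * Complex.I)) (R * Complex.exp (θ₄ * Complex.I))) :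
    (K ∩ L).Nonempty := by
  obtain ⟨γ, hγ⟩ := hKj
  obtain ⟨δ, hδ⟩ := hLj
  have hγ' : ∀ s, γ.extend s ∈ K := fun s => hγ _
  have hδ' : ∀ s, δ.extend s ∈ L := fun s => hδ _
  obtain ⟨s, t, hst⟩ := exists_eq_of_interleaved hR h12 h23 h34 h41 γ.continuous_extend
    δ.continuous_extend (fun s => by simpa using hK (hγ' s)) (fun s => by simpa using hL (hδ' s))
    γ.extend_zero γ.extend_one δ.extend_zero δ.extend_one
  exact ⟨_, hγ' s, hst ▸ hδ' t⟩

/-! ### Clusters of an embedded graph do not cross -/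

namespace PlaneEmbedding

variable {V κ : Type*} {G : SimpleGraph V} (𝓔 : PlaneEmbedding G)

lemma exists_pos_eq_arc (e : G.edgeSet) {t : unitInterval} (ht : t = 0 ∨ t = 1) :
    ∃ v ∈ (e : Sym2 V), 𝓔.pos v = 𝓔.arc e t := by
  have h : 𝓔.arc e t ∈ s(𝓔.arc e 0, 𝓔.arc e 1) := by
    rcases ht with rfl | rfl <;> simp
  rwa [𝓔.arc_ends, Sym2.mem_map] at h

/-- The part of the embedded graph spanned by the vertices with label `k`. -/
def labelSupport (c : V → κ) (k : κ) : Set ℂ :=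
  {z | (∃ v, c v = k ∧ 𝓔.pos v = z) ∨
    ∃ e : G.edgeSet, (∀ v ∈ (e : Sym2 V), c v = k) ∧ ∃ t, 𝓔.arc e t = z}

lemma labelSupport_subset (c : V → κ) (k : κ) : 𝓔.labelSupport c k ⊆ 𝓔.support := by
  rintro z (⟨v, -, rfl⟩ | ⟨e, -, t, rfl⟩)
  · exact Or.inl ⟨v, rfl⟩
  · exact Or.inr (Set.mem_iUnion.2 ⟨e, t, rfl⟩)

/-- Endpoints of arcs count as vertices, so edge points may be taken interior, where the
disjointness axioms of the embedding apply. -/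
lemma mem_labelSupport_cases {c : V → κ} {k : κ} {z : ℂ} (hz : z ∈ 𝓔.labelSupport c k) :
    (∃ v, c v = k ∧ 𝓔.pos v = z) ∨ ∃ e : G.edgeSet, (∀ v ∈ (e : Sym2 V), c v = k) ∧
      ∃ t, t ≠ 0 ∧ t ≠ 1 ∧ 𝓔.arc e t = z := by
  rcases hz with h | ⟨e, he, t, rfl⟩
  · exact Or.inl h
  · by_cases ht : t = 0 ∨ t = 1
    · obtain ⟨v, hv, hvt⟩ := 𝓔.exists_pos_eq_arc e ht
      exact Or.inl ⟨v, he v hv, hvt⟩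
    · push Not at ht
      exact Or.inr ⟨e, he, t, ht.1, ht.2, rfl⟩

/-- A common point would be either a vertex, which has one label, or interior to a single edge,
whose ends fix the label. -/
lemma disjoint_labelSupport (c : V → κ) {k l : κ} (hkl : k ≠ l) :
    Disjoint (𝓔.labelSupport c k) (𝓔.labelSupport c l) := by
  refine Set.disjoint_left.2 fun z hk hl => ?_
  rcases 𝓔.mem_labelSupport_cases hk with ⟨v, hv, hvz⟩ | ⟨e, he, t, h0, h1, hz⟩ <;>
    rcases 𝓔.mem_labelSupport_cases hl with ⟨w, hw, hwz⟩ | ⟨e', he', t', h0', h1', hz'⟩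
  · have := 𝓔.pos_injective (hvz.trans hwz.symm)
    exact hkl (hv ▸ hw ▸ congrArg c this)
  · exact 𝓔.arc_avoids_vertices e' t' v h0' h1' (hz'.trans hvz.symm)
  · exact 𝓔.arc_avoids_vertices e t w h0 h1 (hz.trans hwz.symm)
  · by_cases hee : e = e'
    · subst hee
      obtain ⟨v, hv, -⟩ := 𝓔.exists_pos_eq_arc e (Or.inl rfl)
      exact hkl ((he v hv).symm.trans (he' v hv))
    · exact 𝓔.arc_disjoint e e' t t' hee h0 h1 h0' h1' (hz.trans hz'.symm)

lemma joinedIn_range_path (f : C(unitInterval, ℂ)) {K : Set ℂ} (hK : Set.range f ⊆ K) :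
    JoinedIn K (f 0) (f 1) :=
  ⟨⟨f, rfl, rfl⟩, fun t => hK ⟨t, rfl⟩⟩

lemma joinedIn_labelSupport {H : SimpleGraph V} (hH : H ≤ G) {u v : V} (h : H.Reachable u v) :
    JoinedIn (𝓔.labelSupport H.connectedComponentMk (H.connectedComponentMk u))
      (𝓔.pos u) (𝓔.pos v) := by
  obtain ⟨p⟩ := h
  induction p with
  | nil => exact JoinedIn.refl (Or.inl ⟨_, rfl, rfl⟩)
  | @cons u w v huw p ih =>
    have hc : H.connectedComponentMk u = H.connectedComponentMk w :=
      SimpleGraph.ConnectedComponent.sound huw.reachable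
    rw [← hc] at ih
    refine JoinedIn.trans ?_ ih
    have hsub : Set.range (𝓔.arc ⟨s(u, w), hH huw⟩) ⊆
        𝓔.labelSupport H.connectedComponentMk (H.connectedComponentMk u) := by
      rintro _ ⟨t, rfl⟩
      refine Or.inr ⟨_, fun x hx => ?_, t, rfl⟩
      rcases Sym2.mem_iff.1 hx with rfl | rfl
      · rfl
      · exact hc.symm
    have hj := joinedIn_range_path _ hsub
    have hends := 𝓔.arc_ends ⟨s(u, w), hH huw⟩
    rw [Sym2.map_mk, Sym2.eq_iff] at hends
    rcases hends with ⟨h0, h1⟩ | ⟨h0, h1⟩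
    · rwa [h0, h1] at hj
    · rw [h0, h1] at hj
      exact hj.symm

/-- Two clusters of a subgraph which contain interleaved vertices of the outer face coincide. -/
theorem reachable_of_interleaved {ι : Type*} [LinearOrder ι] {v : ι → V}
    (hv : 𝓔.IsCounterclockwise v) {H : SimpleGraph V} (hH : H ≤ G) {i j k l : ι}
    (hij : i < j) (hjk : j < k) (hkl : k < l) (hik : H.Reachable (v i) (v k))
    (hjl : H.Reachable (v j) (v l)) : H.Reachable (v i) (v j) := by
  obtain ⟨-, -, R, θ, γ, hR, hθ, hθ', -, hγ0, hγ1, hγ, hγd⟩ := hv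
  by_contra hne
  have hball : ∀ u, 𝓔.pos u ∈ Metric.ball (0 : ℂ) R := fun u => hR (Or.inl ⟨u, rfl⟩)
  have hRpos : 0 < R := by
    have := hball (v i)
    rw [mem_ball_zero_iff] at this
    exact (norm_nonneg _).trans_lt this
  have hcircle : ∀ a, ‖γ a 1‖ = R := fun a => by
    rw [hγ1, norm_mul, Complex.norm_exp_ofReal_mul_I, mul_one, Complex.norm_real,
      Real.norm_of_nonneg hRpos.le]
  have hclosed : ∀ a, Set.range (γ a) ⊆ Metric.closedBall 0 R := by
    rintro a _ ⟨t, rfl⟩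
    by_cases h0 : t = 0
    · rw [h0, hγ0]; exact Metric.ball_subset_closedBall (hball _)
    by_cases h1 : t = 1
    · rw [h1, mem_closedBall_zero_iff, hcircle]
    · exact Metric.ball_subset_closedBall (hγ a t h0 h1).2
  set c := H.connectedComponentMk with hc
  have hcne : c (v i) ≠ c (v j) := fun h => hne (SimpleGraph.ConnectedComponent.exact h)
  have hsupp : ∀ a, 𝓔.labelSupport c a ⊆ Metric.closedBall 0 R := fun a =>
    (𝓔.labelSupport_subset c a).trans (hR.trans Metric.ball_subset_closedBall)
  have hcik : c (v i) = c (v k) := SimpleGraph.ConnectedComponent.sound hik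
  have hcjl : c (v j) = c (v l) := SimpleGraph.ConnectedComponent.sound hjl
  -- The arc starts at a vertex of another cluster, runs through the complement of the graph and
  -- ends on the circle, outside the open ball containing the graph.
  have harc : ∀ a q, c (v a) ≠ q → Disjoint (𝓔.labelSupport c q) (Set.range (γ a)) := by
    intro a q haq
    refine Set.disjoint_right.2 ?_
    rintro _ ⟨t, rfl⟩ hz
    by_cases h0 : t = 0
    · rw [h0, hγ0] at hz
      exact Set.disjoint_left.1 (𝓔.disjoint_labelSupport c haq) (Or.inl ⟨_, rfl, rfl⟩) hz
    by_cases h1 : t = 1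
    · have := hR (𝓔.labelSupport_subset c q hz)
      rw [h1, mem_ball_zero_iff, hcircle] at this
      exact this.false
    · exact (hγ a t h0 h1).1.1 (𝓔.labelSupport_subset c q hz)
  -- The cluster is prolonged to the circle by the two outer arcs, so that the crossing theorem in
  -- the disc applies.
  let K : ι → ι → Set ℂ := fun a b =>
    𝓔.labelSupport c (c (v a)) ∪ (Set.range (γ a) ∪ Set.range (γ b))
  have hKsub : ∀ a b, K a b ⊆ Metric.closedBall 0 R := fun a b =>
    Set.union_subset (hsupp _) (Set.union_subset (hclosed a) (hclosed b))
  have hKjoin : ∀ a b, H.Reachable (v a) (v b) →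
      JoinedIn (K a b) (R * Complex.exp (θ a * Complex.I)) (R * Complex.exp (θ b * Complex.I)) := by
    intro a b hab
    rw [← hγ1, ← hγ1]
    have h1 : JoinedIn (K a b) (γ a 0) (γ a 1) := joinedIn_range_path _ fun z hz => Or.inr (Or.inl hz)
    have h2 : JoinedIn (K a b) (γ b 0) (γ b 1) := joinedIn_range_path _ fun z hz => Or.inr (Or.inr hz)
    have h3 : JoinedIn (K a b) (γ a 0) (γ b 0) := by
      rw [hγ0, hγ0]
      exact (𝓔.joinedIn_labelSupport hH hab).mono Set.subset_union_left
    exact h1.symm.trans (h3.trans h2)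
  obtain ⟨z, hz, hz'⟩ := nonempty_inter_of_joinedIn hRpos (hθ hij) (hθ hjk) (hθ hkl) (hθ' i l)
    (hKsub i k) (hKsub j l) (hKjoin i k hik) (hKjoin j l hjl)
  refine Set.disjoint_left.1 (?_ : Disjoint (K i k) (K j l)) hz hz'
  simp only [K, Set.disjoint_union_left, Set.disjoint_union_right]
  refine ⟨⟨𝓔.disjoint_labelSupport c hcne, (harc i _ hcne).symm,
      (harc k _ (hcik ▸ hcne)).symm⟩,
    ⟨harc j _ hcne.symm, hγd _ _ hij.ne, hγd _ _ hjk.ne'⟩,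
    ⟨harc l _ (hcjl ▸ hcne.symm), hγd _ _ (hij.trans (hjk.trans hkl)).ne, hγd _ _ hkl.ne⟩⟩

end PlaneEmbedding

/-! ### Noncrossing partitions into blocks of even size -/

/-- The ranks run through `0, …, |s| - 1`, so the sum is `1 - 1 + 1 - ⋯`. -/
lemma sum_neg_one_pow_rank {α : Type*} [LinearOrder α] (s : Finset α) :
    ∑ x ∈ s, (-1 : ℤ) ^ (s.filter (· < x)).card = if Even s.card then 0 else 1 := by
  induction s using Finset.induction_on_max with
  | empty => simp
  | insert a s ha ih =>
    have has : a ∉ s := fun h => (ha a h).false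
    have h1 : (insert a s).filter (· < a) = s := by
      rw [Finset.filter_insert, if_neg (lt_irrefl a)]
      exact Finset.filter_true_of_mem ha
    have h2 : ∀ x ∈ s, (insert a s).filter (· < x) = s.filter (· < x) := fun x hx => by
      rw [Finset.filter_insert, if_neg (ha x hx).not_gt]
    rw [Finset.sum_insert has, h1, Finset.sum_congr rfl fun x hx => by rw [h2 x hx], ih,
      Finset.card_insert_of_notMem has]
    by_cases h : Even s.card
    · simp [h, Nat.even_add_one]
    · simp [h, Nat.even_add_one, (Nat.not_even_iff_odd.1 h).neg_one_pow]

section Noncrossing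

variable {m : ℕ} {κ : Type*} [DecidableEq κ] {c : Fin m → κ}

/-- Between two elements of a block of a noncrossing partition into even blocks, there is an even
number of elements of the other blocks. -/
lemma even_card_between (hc : ∀ i j k l : Fin m, i < j → j < k → k < l → c i = c k → c j = c l →
      c i = c j) (heven : ∀ q, Even (Finset.univ.filter fun i => c i = q).card)
    {x y : Fin m} (hxy : x < y) (hcxy : c x = c y) :
    Even (Finset.univ.filter fun i => x < i ∧ i < y ∧ c i ≠ c x).card := by
  set T := Finset.univ.filter fun i => x < i ∧ i < y ∧ c i ≠ c x with hT
  rw [Finset.card_eq_sum_card_image c T]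
  refine Finset.even_sum _ fun q hq => ?_
  obtain ⟨z, hz, rfl⟩ := Finset.mem_image.1 hq
  obtain ⟨hxz, hzy, hzc⟩ : x < z ∧ z < y ∧ c z ≠ c x := by simpa [hT] using hz
  -- A foreign block meeting the interval lies entirely inside it, since otherwise it would cross
  -- the block of `x` and `y`.
  suffices h : (T.filter fun i => c i = c z) = Finset.univ.filter fun i => c i = c z from
    h ▸ heven (c z)
  ext i
  simp only [hT, Finset.mem_filter, Finset.mem_univ, true_and]
  refine ⟨fun h => h.2, fun h => ⟨⟨?_, ?_, h ▸ hzc⟩, h⟩⟩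
  · by_contra! hix
    rcases hix.lt_or_eq with hlt | rfl
    · exact hzc (h ▸ (hc i x z y hlt hxz hzy h hcxy))
    · exact hzc h.symm
  · by_contra! hyi
    rcases hyi.lt_or_eq with hlt | rfl
    · exact hzc (hc x z y i hxz hzy hlt hcxy h.symm).symm
    · exact hzc (h ▸ hcxy.symm)

/-- In a noncrossing partition into even blocks, the parities alternate along each block. -/
lemma sum_neg_one_pow_block (hc : ∀ i j k l : Fin m, i < j → j < k → k < l → c i = c k →
      c j = c l → c i = c j) (heven : ∀ q, Even (Finset.univ.filter fun i => c i = q).card) (q : κ) :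
    ∑ i with c i = q, (-1 : ℤ) ^ (i : ℕ) = 0 := by
  set C := Finset.univ.filter fun i => c i = q with hC
  rcases C.eq_empty_or_nonempty with h | h
  · rw [h, Finset.sum_empty]
  set x := C.min' h with hx
  have hxC : c x = q := by simpa [hC] using C.min'_mem h
  -- The distance from the minimum `x` to `y` is the rank of `y` in its block plus the even number
  -- of foreign elements in between.
  have hrank : ∀ y ∈ C, (-1 : ℤ) ^ (y : ℕ) =
      (-1) ^ (x : ℕ) * (-1) ^ (C.filter (· < y)).card := by
    intro y hy
    have hyC : c y = q := by simpa [hC] using hy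
    rcases (C.min'_le y hy).lt_or_eq with hlt | heq
    · have hsplit : (Finset.Ico x y).card = (C.filter (· < y)).card +
          (Finset.univ.filter fun i => x < i ∧ i < y ∧ c i ≠ c x).card := by
        rw [← Finset.card_filter_add_card_filter_not (s := Finset.Ico x y) (fun i => c i = q)]
        congr 2
        · ext i
          simp only [hC, Finset.mem_filter, Finset.mem_Ico, Finset.mem_univ, true_and]
          exact ⟨fun h => ⟨h.2, h.1.2⟩, fun h => ⟨⟨C.min'_le i (by simp [hC, h.1]), h.2⟩, h.1⟩⟩
        · ext i
          simp only [Finset.mem_filter, Finset.mem_Ico, Finset.mem_univ, true_and, hxC]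
          refine ⟨fun h => ⟨h.1.1.lt_of_ne ?_, h.1.2, h.2⟩, fun h => ⟨⟨h.1.le, h.2.1⟩, h.2.2⟩⟩
          rintro rfl
          exact h.2 hxC
      have hev := even_card_between hc heven hlt (hxC.trans hyC.symm)
      rw [Fin.card_Ico] at hsplit
      have hxy : (x : ℕ) < y := hlt
      have : (y : ℕ) = x + (C.filter (· < y)).card +
          (Finset.univ.filter fun i => x < i ∧ i < y ∧ c i ≠ c x).card := by omega
      rw [this, pow_add, hev.neg_one_pow, mul_one, pow_add]
    · rw [← heq, Finset.filter_false_of_mem fun z hz => (C.min'_le z hz).not_gt]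
      simp [hx]
  rw [Finset.sum_congr rfl hrank, ← Finset.mul_sum, sum_neg_one_pow_rank, if_pos (heven q), mul_zero]

/-- If a noncrossing partition has even blocks, on each of which `ε` is constant, then the
alternating sum of `ε` vanishes. -/
theorem sum_neg_one_pow_mul_eq_zero (hc : ∀ i j k l : Fin m, i < j → j < k → k < l → c i = c k →
      c j = c l → c i = c j) (heven : ∀ q, Even (Finset.univ.filter fun i => c i = q).card)
    {ε : Fin m → ℤ} (hε : ∀ i j, c i = c j → ε i = ε j) :
    ∑ i : Fin m, (-1 : ℤ) ^ (i : ℕ) * ε i = 0 := by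
  rw [← Finset.sum_fiberwise_of_maps_to (s := Finset.univ) (t := Finset.univ.image c) (g := c)
    fun i _ => Finset.mem_image_of_mem c (Finset.mem_univ i)]
  refine Finset.sum_eq_zero fun q hq => ?_
  obtain ⟨x, -, rfl⟩ := Finset.mem_image.1 hq
  have : ∀ i ∈ Finset.univ.filter fun i => c i = c x,
      (-1 : ℤ) ^ (i : ℕ) * ε i = (-1) ^ (i : ℕ) * ε x := fun i hi => by
    rw [hε i x (by simpa using hi)]
  rw [Finset.sum_congr rfl this, ← Finset.sum_mul, sum_neg_one_pow_block hc heven, zero_mul]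

end Noncrossing

set_option linter.unusedSectionVars false

namespace AshkinTeller

/-! ### Products over nodes -/

section Nodes

variable {V : Type*} [DecidableEq V] {A₁ A₂ B₁ B₂ : Finset V}

lemma mem_nodes {x : V × Bool} : x ∈ nodes A₁ A₂ B₁ B₂ ↔
    (x.2 = false ∧ (x.1 ∈ A₁ ∨ x.1 ∈ A₂ ∨ x.1 ∈ B₁ ∨ x.1 ∈ B₂)) ∨
      (x.2 = true ∧ (x.1 ∈ A₂ ∨ x.1 ∈ B₂)) := by
  simp only [nodes, Finset.mem_union, Finset.mem_product, Finset.mem_singleton]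
  tauto

/-- A product over the nodes as a product over simple and doubled vertices. -/
lemma prod_nodes (hA : Disjoint A₁ A₂) (hB : Disjoint B₁ B₂)
    (hAB : Disjoint (A₁ ∪ A₂) (B₁ ∪ B₂)) (f g : V → ℝ) :
    ∏ x ∈ nodes A₁ A₂ B₁ B₂, (if x ∈ blue A₁ A₂ B₁ B₂ then g x.1 else f x.1) =
      (∏ v ∈ A₁, f v) * (∏ v ∈ A₂, f v ^ 2) * (∏ v ∈ B₁, g v) * (∏ v ∈ B₂, g v ^ 2) := by
  have h1 : ∀ x ∈ nodes A₁ A₂ B₁ B₂, (if x ∈ blue A₁ A₂ B₁ B₂ then g x.1 else f x.1) =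
      (fun v => if v ∈ B₁ ∪ B₂ then g v else f v) x.1 := fun x hx => by
    simp [blue, hx]
  rw [Finset.prod_congr rfl h1, nodes, Finset.prod_union, Finset.prod_product,
    Finset.prod_product]
  · simp only [Finset.prod_singleton]
    rw [Finset.union_assoc, Finset.prod_union hAB, Finset.prod_union hA, Finset.prod_union hB,
      Finset.prod_union]
    · have hf : ∀ S ⊆ A₁ ∪ A₂, ∏ v ∈ S, (if v ∈ B₁ ∪ B₂ then g v else f v) = ∏ v ∈ S, f v :=
        fun S hS => Finset.prod_congr rfl fun v hv =>
          if_neg (Finset.disjoint_left.1 hAB (hS hv))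
      have hg : ∀ S ⊆ B₁ ∪ B₂, ∏ v ∈ S, (if v ∈ B₁ ∪ B₂ then g v else f v) = ∏ v ∈ S, g v :=
        fun S hS => Finset.prod_congr rfl fun v hv => if_pos (hS hv)
      rw [hf _ Finset.subset_union_left, hf _ Finset.subset_union_right,
        hg _ Finset.subset_union_left, hg _ Finset.subset_union_right, Finset.prod_pow,
        Finset.prod_pow]
      ring
    · exact hAB.mono Finset.subset_union_right Finset.subset_union_right
  · rw [Finset.disjoint_left]
    rintro ⟨v, b⟩ h h'
    simp only [Finset.mem_product, Finset.mem_singleton] at h h'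
    simp [h.2] at h'

end Nodes

/-! ### Spin algebra and the clusters of `τ` -/

section Spin

variable {V : Type*}

lemma spin_mul (σ τ : Config V) (v : V) : spin (σ * τ) v = spin σ v * spin τ v := by
  simp [spin]

lemma spin_sq (σ : Config V) (v : V) : spin σ v * spin σ v = 1 := by
  rcases Int.units_eq_one_or (σ v) with h | h <;> simp [spin, h]

lemma edgeSpin_mk (σ : Config V) (u v : V) : edgeSpin σ s(u, v) = spin σ u * spin σ v := rfl

lemma edgeSpin_mul (σ τ : Config V) (e : Sym2 V) :
    edgeSpin (σ * τ) e = edgeSpin σ e * edgeSpin τ e := by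
  induction e with
  | h u v => simp only [edgeSpin_mk, spin_mul]; ring

lemma edgeSpin_neg_one (e : Sym2 V) : edgeSpin (-1 : Config V) e = 1 := by
  induction e with
  | h u v => simp [edgeSpin_mk, spin]

lemma edgeSpin_sq (σ : Config V) (e : Sym2 V) : edgeSpin σ e * edgeSpin σ e = 1 := by
  induction e with
  | h u v =>
    rw [edgeSpin_mk, mul_mul_mul_comm, spin_sq, spin_sq, one_mul]

/-- The edges along which `τ` is constant. -/
def agreeGraph (G : SimpleGraph V) (τ : Config V) : SimpleGraph V where
  Adj u v := G.Adj u v ∧ τ u = τ v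
  symm := ⟨fun _ _ h => ⟨h.1.symm, h.2.symm⟩⟩
  loopless := ⟨fun _ h => G.loopless.irrefl _ h.1⟩

lemma agreeGraph_le (G : SimpleGraph V) (τ : Config V) : agreeGraph G τ ≤ G := fun _ _ h => h.1

lemma eq_of_reachable_agreeGraph {G : SimpleGraph V} {τ : Config V} {u v : V} (h : (agreeGraph G τ).Reachable u v) :
    τ u = τ v := by
  obtain ⟨p⟩ := h
  induction p with
  | nil => rfl
  | cons h _ ih => exact h.2.trans ih

end Spin

/-! ### Expansion of the fields and cluster flips -/

section Model

variable {V : Type*} [Fintype V] [DecidableEq V] (G : SimpleGraph V) [DecidableRel G.Adj]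
  (J U : Sym2 V → ℝ)

lemma weight_pos (p : Config V × Config V) : 0 < weight G J U p :=
  Finset.prod_pos fun _ _ => Real.exp_pos _

lemma partitionFunction_pos : 0 < partitionFunction G J U :=
  Finset.sum_pos (fun p _ => weight_pos G J U p) Finset.univ_nonempty

lemma weight_congr {p q : Config V × Config V}
    (h : ∀ e ∈ G.edgeSet, edgeSpin p.1 e + edgeSpin p.2 e = edgeSpin q.1 e + edgeSpin q.2 e ∧
      edgeSpin p.1 e * edgeSpin p.2 e = edgeSpin q.1 e * edgeSpin q.2 e) :
    weight G J U p = weight G J U q := by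
  refine Finset.prod_congr rfl fun e he => ?_
  obtain ⟨h1, h2⟩ := h e (SimpleGraph.mem_edgeFinset.1 he)
  rw [h1, h2]

lemma expect_eq_div (f : Config V × Config V → ℝ) :
    expect G J U f = (∑ p, f p * weight G J U p) / partitionFunction G J U := by
  simp only [expect, prob, Finset.sum_div, mul_div_assoc]

lemma expect_congr {f g : Config V × Config V → ℝ} (h : ∀ p, f p = g p) :
    expect G J U f = expect G J U g := by
  rw [funext h]

lemma expect_sum {ι : Type*} (s : Finset ι) (a : ι → ℝ) (f : ι → Config V × Config V → ℝ) :
    expect G J U (fun p => ∑ i ∈ s, a i * f i p) = ∑ i ∈ s, a i * expect G J U (f i) := by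
  simp only [expect, Finset.sum_mul, Finset.mul_sum]
  rw [Finset.sum_comm]
  simp only [mul_assoc]

/-- Flipping all the spins of the second configuration kills the odd correlations. -/
lemma spinCorr_eq_zero_of_odd (S T : Finset (V × Bool)) (hT : Odd T.card) :
    spinCorr G J U S T = 0 := by
  have key : ∑ p : Config V × Config V,
      ((∏ x ∈ S, spin p.1 x.1) * ∏ x ∈ T, spin p.2 x.1) * weight G J U p =
      -∑ p : Config V × Config V,
        ((∏ x ∈ S, spin p.1 x.1) * ∏ x ∈ T, spin p.2 x.1) * weight G J U p := by
    rw [← Finset.sum_neg_distrib]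
    refine Fintype.sum_equiv
      ((Equiv.refl (Config V)).prodCongr (Equiv.mulLeft (-1 : Config V))) _ _ fun p => ?_
    have hw : weight G J U (p.1, -1 * p.2) = weight G J U p :=
      weight_congr G J U fun e _ => by simp only [edgeSpin_mul, edgeSpin_neg_one, one_mul, and_self]
    have hs : ∀ x : V × Bool, spin (-1 * p.2) x.1 = -1 * spin p.2 x.1 := fun x => by
      rw [spin_mul]; simp [spin]
    simp only [Equiv.prodCongr_apply, Prod.map, Equiv.refl_apply, Equiv.coe_mulLeft, hw, hs,
      Finset.prod_mul_distrib, Finset.prod_const, hT.neg_one_pow]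
    ring
  rw [spinCorr, expect_eq_div, div_eq_zero_iff]
  left
  linarith

/-- A product over nodes of the fields `φ` and `φ̃`. -/
def nodeField (N B : Finset (V × Bool)) (p : Config V × Config V) : ℝ :=
  ∏ x ∈ N, if x ∈ B then phiTilde p x.1 else phi p x.1

lemma phiCorr_eq_expect_nodeField {A₁ A₂ B₁ B₂ : Finset V} (hA : Disjoint A₁ A₂)
    (hB : Disjoint B₁ B₂) (hAB : Disjoint (A₁ ∪ A₂) (B₁ ∪ B₂)) :
    phiCorr G J U A₁ A₂ B₁ B₂ =
      expect G J U (nodeField (nodes A₁ A₂ B₁ B₂) (blue A₁ A₂ B₁ B₂)) :=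
  expect_congr G J U fun p => (prod_nodes hA hB hAB (phi p) (phiTilde p)).symm

/-- This expands the product of the factors `(σ ± σ̃) / 2`; `S` records the nodes at which the term
`σ̃` is chosen. -/
lemma nodeField_eq_sum (N B : Finset (V × Bool)) (p : Config V × Config V) :
    nodeField N B p = ∑ S ∈ N.powerset, (1 / 2 ^ N.card * (-1) ^ (S ∩ B).card) *
      ((∏ x ∈ N \ S, spin p.1 x.1) * ∏ x ∈ S, spin p.2 x.1) := by
  have h1 : ∀ x ∈ N, (if x ∈ B then phiTilde p x.1 else phi p x.1) =
      (1 / 2) * ((if x ∈ B then (-1) else 1) * spin p.2 x.1 + spin p.1 x.1) := fun x _ => by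
    split_ifs <;> simp only [phi, phiTilde] <;> ring
  rw [nodeField, Finset.prod_congr rfl h1, Finset.prod_mul_distrib, Finset.prod_const,
    Finset.prod_add, Finset.mul_sum]
  refine Finset.sum_congr rfl fun S _ => ?_
  rw [Finset.prod_mul_distrib, Finset.prod_ite_mem, Finset.prod_const, one_div, inv_pow, one_div]
  ring

/-- The correlation of the fields as a signed sum of spin correlations. -/
lemma expect_nodeField (N B : Finset (V × Bool)) :
    expect G J U (nodeField N B) = 1 / 2 ^ N.card * ∑ S ∈ evenSubsets N,
      (-1) ^ (S ∩ B).card * spinCorr G J U (N \ S) S := by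
  rw [expect_congr G J U (nodeField_eq_sum N B), expect_sum, evenSubsets, Finset.sum_filter,
    Finset.mul_sum]
  refine Finset.sum_congr rfl fun S _ => ?_
  split_ifs with h
  · rw [mul_assoc]; rfl
  · have := spinCorr_eq_zero_of_odd G J U (N \ S) S (Nat.not_even_iff_odd.1 h)
    rw [spinCorr] at this
    rw [this, mul_zero, mul_zero]

/-- The weight does not change if both configurations are flipped on clusters of their product. -/
lemma weight_flip (τ σ s : Config V) (hs : ∀ u v, (agreeGraph G τ).Adj u v → s u = s v) :
    weight G J U (σ * s, σ * s * τ) = weight G J U (σ, σ * τ) := by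
  refine weight_congr G J U fun e he => ?_
  have hss := edgeSpin_sq s e
  simp only [edgeSpin_mul]
  constructor
  -- If `τ` agrees at the two ends, then so does `s`, and its edge product is `1`. If not, the
  -- factor `1 + τ_u τ_v` multiplying `J` vanishes.
  · induction e with
    | h u v =>
      rcases eq_or_ne (τ u) (τ v) with h | h
      · have : s u = s v := hs u v ⟨he, h⟩
        have h1 : edgeSpin s s(u, v) = 1 := by
          rw [edgeSpin_mk, spin, spin, this]; exact spin_sq s v
        rw [h1]; ring
      · have h1 : edgeSpin τ s(u, v) = -1 := by
          rw [edgeSpin_mk, spin, spin]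
          rcases Int.units_eq_one_or (τ u) with h1 | h1 <;>
            rcases Int.units_eq_one_or (τ v) with h2 | h2 <;> simp_all
        rw [h1]; ring
  · linear_combination (edgeSpin σ e * (edgeSpin σ e * edgeSpin τ e)) * hss

/-- If some cluster of `τ` contains an odd number of nodes, the sum over `σ` vanishes. -/
lemma sum_nodeField_eq_zero_of_odd (N B : Finset (V × Bool)) (τ s : Config V)
    (hs : ∀ u v, (agreeGraph G τ).Adj u v → s u = s v)
    (hodd : ∏ x ∈ N, spin s x.1 = -1) :
    ∑ σ : Config V, nodeField N B (σ, σ * τ) * weight G J U (σ, σ * τ) = 0 := by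
  have key : ∑ σ : Config V, nodeField N B (σ, σ * τ) * weight G J U (σ, σ * τ) =
      -∑ σ : Config V, nodeField N B (σ, σ * τ) * weight G J U (σ, σ * τ) := by
    conv_lhs => rw [← Equiv.sum_comp (Equiv.mulRight s)]
    rw [← Finset.sum_neg_distrib]
    refine Finset.sum_congr rfl fun σ _ => ?_
    -- Both configurations are multiplied by `s`, so each field, of either color, picks up the spin
    -- of `s` at its node.
    have hf : nodeField N B (σ * s, σ * s * τ) = -nodeField N B (σ, σ * τ) := by
      rw [← neg_one_mul, ← hodd, nodeField, nodeField, ← Finset.prod_mul_distrib]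
      refine Finset.prod_congr rfl fun x _ => ?_
      split_ifs <;> simp only [phi, phiTilde, spin_mul] <;> ring
    rw [Equiv.coe_mulRight, weight_flip G J U τ σ s hs, hf, neg_mul]
  linarith

/-- The fields vanish unless `τ` is `-1` at the blue nodes and `1` at the others. -/
lemma nodeField_eq_zero_of_mem {N B : Finset (V × Bool)} {τ : Config V} {x : V × Bool}
    (hx : x ∈ N) (hτ : τ x.1 ≠ if x ∈ B then -1 else 1) (σ : Config V) :
    nodeField N B (σ, σ * τ) = 0 := by
  refine Finset.prod_eq_zero hx ?_
  rcases Int.units_eq_one_or (τ x.1) with h | h <;> split_ifs at hτ ⊢ <;>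
    simp_all [phi, phiTilde, spin]

/-- The substitution `σ̃ = σ τ` allows `τ` to be fixed before summing over `σ`. -/
lemma sum_pair (f : Config V × Config V → ℝ) : ∑ p, f p = ∑ τ, ∑ σ, f (σ, σ * τ) := by
  rw [Fintype.sum_prod_type, Finset.sum_comm (f := fun τ σ => f (σ, σ * τ))]
  exact Finset.sum_congr rfl fun σ _ => (Equiv.sum_comp (Equiv.mulLeft σ) fun τ => f (σ, τ)).symm

end Model

end AshkinTeller

namespace AshkinTeller

/-! ### Noncrossing clusters and the count of sources and sinks -/

section Order

variable {V : Type*} [DecidableEq V] {A₁ A₂ B₁ B₂ : Finset V} {G : SimpleGraph V}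
  {𝓔 : PlaneEmbedding G} {m : ℕ} {node : Fin m → V × Bool}

lemma IsNodeOrder.mem_nodes (h : IsNodeOrder A₁ A₂ B₁ B₂ 𝓔 node) (i : Fin m) :
    node i ∈ nodes A₁ A₂ B₁ B₂ :=
  h.image_eq ▸ Finset.mem_image_of_mem node (Finset.mem_univ i)

lemma IsNodeOrder.card_nodes (h : IsNodeOrder A₁ A₂ B₁ B₂ 𝓔 node) :
    (nodes A₁ A₂ B₁ B₂).card = m := by
  rw [← h.image_eq, Finset.card_image_of_injective _ h.injective, Finset.card_univ,
    Fintype.card_fin]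

/-- The geometric order concerns distinct vertices, hence first copies only. As a second copy
follows its first one immediately, passing to first copies is monotone. -/
lemma IsNodeOrder.exists_first_copy (h : IsNodeOrder A₁ A₂ B₁ B₂ 𝓔 node) (i : Fin m) :
    ∃ b : Fin m, (node b).2 = false ∧ (node b).1 = (node i).1 ∧ b ≤ i ∧ ∀ j < i, j ≤ b := by
  rcases hi : node i with ⟨v, _ | _⟩
  · exact ⟨i, by rw [hi], by rw [hi], le_rfl, fun j hj => hj.le⟩
  · have hv : (v, false) ∈ nodes A₁ A₂ B₁ B₂ := by
      have := h.mem_nodes i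
      rw [hi, AshkinTeller.mem_nodes] at this
      rw [AshkinTeller.mem_nodes]
      simp only [reduceCtorEq, false_and, true_and, or_false, false_or] at this ⊢
      tauto
    rw [← h.image_eq] at hv
    obtain ⟨b, -, hb⟩ := Finset.mem_image.1 hv
    have hbi := h.doubled b i v hb hi
    refine ⟨b, by rw [hb], by rw [hb], ?_, fun j hj => ?_⟩
    · rw [Fin.le_def]; omega
    · rw [Fin.lt_def] at hj; rw [Fin.le_def]; omega

/-- The clusters of a subgraph induce a noncrossing partition of the nodes. -/
lemma IsNodeOrder.reachable_of_interleaved (h : IsNodeOrder A₁ A₂ B₁ B₂ 𝓔 node)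
    {H : SimpleGraph V} (hH : H ≤ G) {i j k l : Fin m} (hij : i < j) (hjk : j < k) (hkl : k < l)
    (hik : H.Reachable (node i).1 (node k).1) (hjl : H.Reachable (node j).1 (node l).1) :
    H.Reachable (node i).1 (node j).1 := by
  choose b hb hbv hble hbge using h.exists_first_copy
  have hmono : ∀ {x y}, x < y → b x ≤ b y := fun hxy => (hble _).trans (hbge _ _ hxy)
  have hlt : ∀ {x y}, x < y → (node x).1 ≠ (node y).1 → b x < b y := fun {x y} hxy hne =>
    (hmono hxy).lt_of_ne fun he => hne (by rw [← hbv x, ← hbv y, he])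
  -- If two consecutive nodes share a vertex, the claim follows from the given reachabilities.
  -- Otherwise the four first copies are strictly increasing.
  by_cases h1 : (node i).1 = (node j).1
  · rw [h1]
  by_cases h2 : (node j).1 = (node k).1
  · rwa [h2]
  by_cases h3 : (node k).1 = (node l).1
  · rw [h3] at hik
    exact hik.trans hjl.symm
  have := 𝓔.reachable_of_interleaved h.counterclockwise hH
    (i := ⟨b i, hb i⟩) (j := ⟨b j, hb j⟩) (k := ⟨b k, hb k⟩) (l := ⟨b l, hb l⟩)
    (hlt hij h1) (hlt hjk h2) (hlt hkl h3) (by rwa [hbv, hbv]) (by rwa [hbv, hbv])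
  rwa [hbv, hbv] at this

lemma mem_red_iff_not_mem_blue (hAB : Disjoint (A₁ ∪ A₂) (B₁ ∪ B₂)) {x : V × Bool}
    (hx : x ∈ nodes A₁ A₂ B₁ B₂) : x ∈ red A₁ A₂ B₁ B₂ ↔ x ∉ blue A₁ A₂ B₁ B₂ := by
  simp only [red, blue, Finset.mem_filter, hx, true_and]
  refine ⟨fun h => Finset.disjoint_left.1 hAB h, fun h => ?_⟩
  rw [AshkinTeller.mem_nodes] at hx
  simp only [Finset.mem_union] at h ⊢
  tauto

/-- The number of sources minus the number of sinks as an alternating sum. -/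
lemma IsNodeOrder.card_sources_sub_card_sinks (h : IsNodeOrder A₁ A₂ B₁ B₂ 𝓔 node)
    (hAB : Disjoint (A₁ ∪ A₂) (B₁ ∪ B₂)) :
    ((sources A₁ A₂ B₁ B₂ node).card : ℤ) - (sinks A₁ A₂ B₁ B₂ node).card =
      ∑ i : Fin m, (-1) ^ (i : ℕ) * (if node i ∈ blue A₁ A₂ B₁ B₂ then 1 else -1) := by
  have hred := fun i => mem_red_iff_not_mem_blue hAB (h.mem_nodes i)
  -- The index `i` starts at `0`, so a node is odd in the numbering from `1` exactly when `i` is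
  -- even.
  have h1 : sources A₁ A₂ B₁ B₂ node = (Finset.univ.filter fun i : Fin m =>
      (node i ∈ blue A₁ A₂ B₁ B₂ ↔ Even (i : ℕ))).image node := by
    ext x
    simp only [sources, oddNodes, evenNodes, Finset.mem_union, Finset.mem_inter, Finset.mem_image,
      Finset.mem_filter, Finset.mem_univ, true_and]
    constructor
    · rintro (⟨⟨i, hi, rfl⟩, hx⟩ | ⟨⟨i, hi, rfl⟩, hx⟩) <;> refine ⟨i, ?_, rfl⟩
      · simp only [hx, true_iff]; grind
      · rw [hred] at hx; simp only [hx, false_iff]; grind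
    · rintro ⟨i, hi, rfl⟩
      by_cases hx : node i ∈ blue A₁ A₂ B₁ B₂
      · exact Or.inl ⟨⟨i, (hi.1 hx).add_one, rfl⟩, hx⟩
      · exact Or.inr ⟨⟨i, by grind, rfl⟩, (hred i).2 hx⟩
  have h2 : sinks A₁ A₂ B₁ B₂ node = (Finset.univ.filter fun i : Fin m =>
      ¬ (node i ∈ blue A₁ A₂ B₁ B₂ ↔ Even (i : ℕ))).image node := by
    ext x
    simp only [sinks, oddNodes, evenNodes, Finset.mem_union, Finset.mem_inter, Finset.mem_image,
      Finset.mem_filter, Finset.mem_univ, true_and]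
    constructor
    · rintro (⟨⟨i, hi, rfl⟩, hx⟩ | ⟨⟨i, hi, rfl⟩, hx⟩) <;> refine ⟨i, ?_, rfl⟩
      · simp only [hx, true_iff]; grind
      · rw [hred] at hx; simp only [hx, false_iff]; grind
    · rintro ⟨i, hi, rfl⟩
      by_cases hx : node i ∈ blue A₁ A₂ B₁ B₂
      · exact Or.inl ⟨⟨i, by grind, rfl⟩, hx⟩
      · exact Or.inr ⟨⟨i, by grind, rfl⟩, (hred i).2 hx⟩
  rw [h1, h2, Finset.card_image_of_injective _ h.injective,
    Finset.card_image_of_injective _ h.injective, Finset.card_filter, Finset.card_filter]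
  push_cast
  rw [← Finset.sum_sub_distrib]
  refine Finset.sum_congr rfl fun i _ => ?_
  by_cases hx : node i ∈ blue A₁ A₂ B₁ B₂ <;> rcases Nat.even_or_odd (i : ℕ) with hi | hi
  · simp [hx, hi]
  · simp [hx, hi, Nat.not_even_iff_odd.2 hi]
  · simp [hx, hi]
  · simp [hx, hi, Nat.not_even_iff_odd.2 hi]

end Order

/-! ### Vanishing for unbalanced colorings -/

section Vanishing

variable {V : Type*} [Fintype V] [DecidableEq V] {A₁ A₂ B₁ B₂ : Finset V} {G : SimpleGraph V}
  [DecidableRel G.Adj] {𝓔 : PlaneEmbedding G} {m : ℕ} {node : Fin m → V × Bool}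

/-- For an unbalanced coloring the correlation of the fields vanishes. -/
theorem IsNodeOrder.expect_nodeField_eq_zero (h : IsNodeOrder A₁ A₂ B₁ B₂ 𝓔 node)
    (hAB : Disjoint (A₁ ∪ A₂) (B₁ ∪ B₂)) (hunb : ¬ IsBalanced A₁ A₂ B₁ B₂ node)
    (J U : Sym2 V → ℝ) :
    expect G J U (nodeField (nodes A₁ A₂ B₁ B₂) (blue A₁ A₂ B₁ B₂)) = 0 := by
  classical
  rw [expect_eq_div, sum_pair, Finset.sum_eq_zero, zero_div]
  intro τ _
  by_cases hcol : ∀ x ∈ nodes A₁ A₂ B₁ B₂, τ x.1 = if x ∈ blue A₁ A₂ B₁ B₂ then -1 else 1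
  swap
  · push Not at hcol
    obtain ⟨x, hx, hτ⟩ := hcol
    exact Finset.sum_eq_zero fun σ _ => by rw [nodeField_eq_zero_of_mem hx hτ, zero_mul]
  set H := agreeGraph G τ with hH
  set c : Fin m → H.ConnectedComponent := fun i => H.connectedComponentMk (node i).1 with hc
  by_cases heven : ∀ q, Even (Finset.univ.filter fun i => c i = q).card
  -- All clusters being even, the noncrossing argument would make the coloring balanced.
  · refine absurd ?_ hunb
    have hsum : ∑ i : Fin m, (-1 : ℤ) ^ (i : ℕ) *
        (if node i ∈ blue A₁ A₂ B₁ B₂ then 1 else -1) = 0 := by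
      refine sum_neg_one_pow_mul_eq_zero (c := c) (fun i j k l hij hjk hkl hik hjl => ?_) heven
        fun i j hij => ?_
      · exact SimpleGraph.ConnectedComponent.sound (h.reachable_of_interleaved
          (agreeGraph_le G τ) hij hjk hkl (SimpleGraph.ConnectedComponent.exact hik)
          (SimpleGraph.ConnectedComponent.exact hjl))
      · have hτ := eq_of_reachable_agreeGraph (SimpleGraph.ConnectedComponent.exact hij)
        rw [hcol _ (h.mem_nodes i), hcol _ (h.mem_nodes j)] at hτ
        split_ifs at hτ ⊢ <;> first | rfl | exact absurd hτ (by decide)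
    rw [← h.card_sources_sub_card_sinks hAB] at hsum
    exact_mod_cast sub_eq_zero.1 hsum
  · push Not at heven
    obtain ⟨q, hq⟩ := heven
    -- The flip `s` is `-1` exactly on the odd cluster `q`.
    refine sum_nodeField_eq_zero_of_odd G J U _ _ τ
      (fun v => if H.connectedComponentMk v = q then -1 else 1) (fun u v huv => ?_) ?_
    · have : H.connectedComponentMk u = H.connectedComponentMk v :=
        SimpleGraph.ConnectedComponent.sound huv.reachable
      simp only [this]
    · rw [← h.image_eq, Finset.prod_image h.injective.injOn]
      have : ∀ i : Fin m, spin (fun v => if H.connectedComponentMk v = q then -1 else 1)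
          (node i).1 = if c i = q then -1 else 1 := fun i => by
        simp only [spin, hc]
        split_ifs <;> simp
      rw [Finset.prod_congr rfl fun i _ => this i, Finset.prod_ite, Finset.prod_const_one, mul_one,
        Finset.prod_const, (Nat.not_even_iff_odd.1 hq).neg_one_pow]

end Vanishing

/-! ### Independence at `U = 0` -/

section Independent

variable {V : Type*} [Fintype V] [DecidableEq V] (G : SimpleGraph V) [DecidableRel G.Adj]
  (J U : Sym2 V → ℝ)

/-- The unnormalised weight of a configuration of the Ising model. -/
def isingWeight (σ : Config V) : ℝ := ∏ e ∈ G.edgeFinset, Real.exp (J e * edgeSpin σ e)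

/-- The probability of a configuration of the Ising model. -/
def isingProb (σ : Config V) : ℝ := isingWeight G J σ / ∑ ρ, isingWeight G J ρ

lemma isingWeight_pos (σ : Config V) : 0 < isingWeight G J σ :=
  Finset.prod_pos fun _ _ => Real.exp_pos _

lemma sum_isingWeight_pos : 0 < ∑ ρ, isingWeight G J ρ :=
  Finset.sum_pos (fun σ _ => isingWeight_pos G J σ) Finset.univ_nonempty

lemma isingProb_nonneg (σ : Config V) : 0 ≤ isingProb G J σ :=
  div_nonneg (isingWeight_pos G J σ).le (sum_isingWeight_pos G J).le

lemma sum_isingProb : ∑ σ, isingProb G J σ = 1 := by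
  rw [← div_self (sum_isingWeight_pos G J).ne', Finset.sum_div]
  rfl

variable {U} (hU : ∀ e ∈ G.edgeSet, U e = 0)
include hU

/-- Without the four-body interaction, the model is a pair of independent Ising models. -/
lemma prob_eq_mul (p : Config V × Config V) :
    prob G J U p = isingProb G J p.1 * isingProb G J p.2 := by
  have hw : ∀ p, weight G J U p = isingWeight G J p.1 * isingWeight G J p.2 := fun p => by
    rw [weight, isingWeight, isingWeight, ← Finset.prod_mul_distrib]
    refine Finset.prod_congr rfl fun e he => ?_
    rw [hU e (SimpleGraph.mem_edgeFinset.1 he), ← Real.exp_add]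
    ring_nf
  rw [prob, partitionFunction, Finset.sum_congr rfl fun p _ => hw p, hw, isingProb, isingProb,
    Fintype.sum_prod_type, ← Finset.sum_mul_sum, mul_div_mul_comm]

lemma expect_mul (f g : Config V → ℝ) :
    expect G J U (fun p => f p.1 * g p.2) =
      (∑ σ, f σ * isingProb G J σ) * ∑ σ, g σ * isingProb G J σ := by
  rw [expect, Finset.sum_mul_sum, Fintype.sum_prod_type]
  refine Finset.sum_congr rfl fun σ _ => Finset.sum_congr rfl fun ρ _ => ?_
  rw [prob_eq_mul G J hU]
  ring

/-- Both marginals are the same Ising law, so the `σ̃` factor may be written as a correlation of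
`σ`. -/
lemma spinCorr_eq_mul (S T : Finset (V × Bool)) :
    spinCorr G J U S T = spinCorr G J U S ∅ * spinCorr G J U T ∅ := by
  have h : ∀ S T : Finset (V × Bool), spinCorr G J U S T =
      (∑ σ, (∏ x ∈ S, spin σ x.1) * isingProb G J σ) *
        ∑ σ, (∏ x ∈ T, spin σ x.1) * isingProb G J σ := fun S T =>
    expect_mul G J hU (fun σ => ∏ x ∈ S, spin σ x.1) fun σ => ∏ x ∈ T, spin σ x.1
  rw [h S T, h S ∅, h T ∅]
  simp [sum_isingProb]

omit hU

/-- The σ-algebra of the units is pulled back from `ℤ` along an injection, so every set is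
measurable. -/
instance : DiscreteMeasurableSpace ℤˣ :=
  ⟨fun s => ⟨Units.val '' s, trivial, Set.preimage_image_eq s Units.val_injective⟩⟩

open MeasureTheory ProbabilityTheory

/-- The law of the Ising model. -/
def isingLaw : Measure (Config V) :=
  ∑ σ, ENNReal.ofReal (isingProb G J σ) • Measure.dirac σ

lemma sum_smul_dirac_singleton {α : Type*} [Fintype α] [MeasurableSpace α]
    [MeasurableSingletonClass α] (w : α → ENNReal) (a : α) :
    (∑ x, w x • Measure.dirac x) {a} = w a := by
  classical
  simp [Measure.finsetSum_apply, Set.indicator_apply]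

instance : IsProbabilityMeasure (isingLaw G J) := ⟨by
  simp only [isingLaw, Measure.finsetSum_apply, Measure.smul_apply, measure_univ, smul_eq_mul,
    mul_one]
  rw [← ENNReal.ofReal_sum_of_nonneg fun σ _ => isingProb_nonneg G J σ, sum_isingProb,
    ENNReal.ofReal_one]⟩

include hU

lemma law_eq_prod : law G J U = (isingLaw G J).prod (isingLaw G J) := by
  refine Measure.ext_of_singleton fun p => ?_
  rw [law, sum_smul_dirac_singleton, prob_eq_mul G J hU,
    ENNReal.ofReal_mul (isingProb_nonneg G J _), ← Set.singleton_prod_singleton, Measure.prod_prod,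
    isingLaw, sum_smul_dirac_singleton, sum_smul_dirac_singleton]

lemma indepFun_fst_snd : IndepFun Prod.fst Prod.snd (law G J U) := by
  rw [law_eq_prod G J hU, indepFun_iff_map_prod_eq_prod_map_map measurable_fst.aemeasurable
    measurable_snd.aemeasurable]
  simp [Measure.map_fst_prod, Measure.map_snd_prod]

lemma identDistrib_fst_snd :
    IdentDistrib Prod.fst Prod.snd (law G J U) (law G J U) where
  aemeasurable_fst := measurable_fst.aemeasurable
  aemeasurable_snd := measurable_snd.aemeasurable
  map_eq := by
    rw [law_eq_prod G J hU, Measure.map_fst_prod, Measure.map_snd_prod]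

end Independent

end AshkinTeller

end

/-! ### The correlation identities -/

theorem corollary2 {V : Type*} [Fintype V] [DecidableEq V] (G : SimpleGraph V)
    [DecidableRel G.Adj] (hG : G.Connected) (𝓔 : PlaneEmbedding G)
    (A₁ A₂ B₁ B₂ : Finset V)
    (hA : Disjoint A₁ A₂) (hB : Disjoint B₁ B₂) (hAB : Disjoint (A₁ ∪ A₂) (B₁ ∪ B₂))
    (n : ℕ) (node : Fin (2 * n) → V × Bool)
    (hnode : AshkinTeller.IsNodeOrder A₁ A₂ B₁ B₂ 𝓔 node)
    (hunbalanced : ¬ AshkinTeller.IsBalanced A₁ A₂ B₁ B₂ node)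
    (N : Finset (V × Bool)) (hN : N = AshkinTeller.nodes A₁ A₂ B₁ B₂)
    (B : Finset (V × Bool)) (hBlue : B = AshkinTeller.blue A₁ A₂ B₁ B₂)
    (J U : Sym2 V → ℝ) :
    (AshkinTeller.phiCorr G J U A₁ A₂ B₁ B₂ =
        1 / 2 ^ N.card * ∑ S ∈ AshkinTeller.evenSubsets N,
          (-1) ^ (S ∩ B).card * AshkinTeller.spinCorr G J U (N \ S) S ∧
      1 / 2 ^ N.card * ∑ S ∈ AshkinTeller.evenSubsets N,
          (-1) ^ (S ∩ B).card * AshkinTeller.spinCorr G J U (N \ S) S = 0) ∧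
    ((∀ e ∈ G.edgeSet, U e = 0) →
      ProbabilityTheory.IndepFun Prod.fst Prod.snd (AshkinTeller.law G J U) ∧
      ProbabilityTheory.IdentDistrib Prod.fst Prod.snd
        (AshkinTeller.law G J U) (AshkinTeller.law G J U) ∧
      (∀ S ⊆ N, AshkinTeller.spinCorr G J U (N \ S) S =
        AshkinTeller.spinCorr G J U (N \ S) ∅ * AshkinTeller.spinCorr G J U S ∅) ∧
      (Even B.card →
        2 * AshkinTeller.spinCorr G J U N ∅ =
          ∑ S ∈ AshkinTeller.evenSubsets N \ {∅, N},
            (-1) ^ ((S ∩ B).card + 1) *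
              (AshkinTeller.spinCorr G J U S ∅ *
                AshkinTeller.spinCorr G J U (N \ S) ∅))) := by
  subst hN hBlue
  have hexp := AshkinTeller.expect_nodeField G J U (AshkinTeller.nodes A₁ A₂ B₁ B₂)
    (AshkinTeller.blue A₁ A₂ B₁ B₂)
  have hzero := hnode.expect_nodeField_eq_zero hAB hunbalanced J U
  refine ⟨⟨?_, hexp.symm.trans hzero⟩, fun hU =>
    ⟨AshkinTeller.indepFun_fst_snd G J hU, AshkinTeller.identDistrib_fst_snd G J hU,
      fun S _ => AshkinTeller.spinCorr_eq_mul G J hU _ S, fun hB' => ?_⟩⟩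
  · rw [AshkinTeller.phiCorr_eq_expect_nodeField G J U hA hB hAB, hexp]
  · have hcard := hnode.card_nodes
    have hblue : AshkinTeller.blue A₁ A₂ B₁ B₂ ⊆ AshkinTeller.nodes A₁ A₂ B₁ B₂ :=
      Finset.filter_subset _ _
    -- Without nodes there are no sources and no sinks, which is balanced; hence `∅` and `N` index
    -- two different terms.
    have hne : (∅ : Finset (V × Bool)) ≠ AshkinTeller.nodes A₁ A₂ B₁ B₂ := fun h => by
      refine hunbalanced ?_
      rw [← h, Finset.card_empty] at hcard
      have hn : n = 0 := by omega
      subst hn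
      simp [AshkinTeller.IsBalanced, AshkinTeller.sources, AshkinTeller.sinks,
        AshkinTeller.oddNodes, AshkinTeller.evenNodes]
    set N := AshkinTeller.nodes A₁ A₂ B₁ B₂
    set B := AshkinTeller.blue A₁ A₂ B₁ B₂
    have hsum : ∑ S ∈ AshkinTeller.evenSubsets N,
        (-1) ^ (S ∩ B).card * AshkinTeller.spinCorr G J U (N \ S) S = 0 := by
      rw [hexp] at hzero
      exact (mul_eq_zero.1 hzero).resolve_left (by positivity)
    have hsub : ({∅, N} : Finset (Finset (V × Bool))) ⊆ AshkinTeller.evenSubsets N := by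
      intro S hS
      rcases Finset.mem_insert.1 hS with rfl | hS
      · simp [AshkinTeller.evenSubsets]
      · rw [Finset.mem_singleton.1 hS]
        simp [AshkinTeller.evenSubsets, hcard]
    -- The terms `∅` and `N` each equal `⟨σ_N⟩`; the sign of the second is `+1` because the number
    -- of blue nodes is even.
    rw [← Finset.sum_sdiff hsub, Finset.sum_pair hne, Finset.empty_inter, Finset.card_empty,
      pow_zero, Finset.sdiff_empty, Finset.sdiff_self, Finset.inter_eq_right.2 hblue,
      hB'.neg_one_pow, AshkinTeller.spinCorr_eq_mul G J hU ∅ N,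
      AshkinTeller.spinCorr_eq_mul G J hU N ∅] at hsum
    have hempty : AshkinTeller.spinCorr G J U ∅ ∅ = 1 := by
      rw [AshkinTeller.spinCorr, AshkinTeller.expect_eq_div]
      simp only [Finset.prod_empty, one_mul]
      exact div_self (AshkinTeller.partitionFunction_pos G J U).ne'
    have hneg : ∑ S ∈ AshkinTeller.evenSubsets N \ {∅, N}, (-1) ^ ((S ∩ B).card + 1) *
        (AshkinTeller.spinCorr G J U S ∅ * AshkinTeller.spinCorr G J U (N \ S) ∅) =
        -∑ S ∈ AshkinTeller.evenSubsets N \ {∅, N},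
          (-1) ^ (S ∩ B).card * AshkinTeller.spinCorr G J U (N \ S) S := by
      rw [← Finset.sum_neg_distrib]
      refine Finset.sum_congr rfl fun S _ => ?_
      rw [AshkinTeller.spinCorr_eq_mul G J hU (N \ S) S]
      ring
    rw [hneg]
    rw [hempty] at hsum
    linarith
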